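/- Let $k\ge 0$ and let $n_1,\dots,n_k\ge 1$ be integers, $N=n_1\cdots n_k$. For $n\ge 1$ put $\omega_n=e^{2\pi \mathrm{i}/n}$ and define the following $n\times n$ complex matrices with rows and columns indexed by $\mathbb Z_n$, represented by $0,1,\dots,n-1$: $(P_n)_{ab}=\delta_{a,b-1}$ (indices modulo $n$), $(Q_n)_{ab}=\delta_{ab}\,\omega_n^{a}$, $(S_n)_{ab}=\omega_n^{ab}/\sqrt n$, and $(D_n)_{ab}=\delta_{ab}\,\varepsilon_n^{-a}\,\omega_n^{\binom a2}$, where $\varepsilon_n=e^{\pi \mathrm{i}/n}$ (so that $\varepsilon_n^2=\omega_n$) if $n$ is even and $\varepsilon_n=1$ if $n$ is odd. Let $\Pi_n=\{\omega_n^{a}Q_n^{b}P_n^{c} : 0\le a,b,c\le n-1\}$ be the finite Heisenberg group. For $M\in \mathrm{GL}_N(\mathbb C)$ let $\mathrm{Ad}_M$ denote the inner automorphism $X\mapsto MXM^{-1}$ of $\mathrm{GL}_N(\mathbb C)$, let $$\mathcal P_{(n_1,\dots,n_k)}=\{\mathrm{Ad}_{M_1\otimes\cdots\otimes M_k} : M_i\in\Pi_{n_i}\}\subseteq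 \mathrm{Inn}(\mathrm{GL}_N(\mathbb C)),$$ and let $\mathcal N(\mathcal P_{(n_1,\dots,n_k)})$ be its normalizer in $\mathrm{Inn}(\mathrm{GL}_N(\mathbb C))$. For $1\le i<j\le k$ put $$T_{ij}=I_{n_{i+1}\cdots n_{j-1}}\otimes Q_{n_j}^{\,n_j/\gcd(n_i,n_j)},\qquad R_{ij}=I_{n_1\cdots n_{i-1}}\otimes\mathrm{diag}\big(I_{n_{i+1}\cdots n_j},T_{ij},T_{ij}^2,\dots,T_{ij}^{\,n_i-1}\big)\otimes I_{n_{j+1}\cdots n_k}.$$ Then there is a group $\mathcal G_{(n_1,\dots,n_k)}$ of unitary $N\times N$ matrices such that $$\mathcal N(\mathcal P_{(n_1,\dots,n_k)})=\{\mathrm{Ad}_M : M\in\mathcal G_{(n_1,\dots,n_k)}\},$$ and it is generated by the (unitary) matrices $$I_{n_1\cdots n_{i-1}}\otimes X\otimes I_{n_{i+1}\cdots n_k},\qquad X\in\{P_{n_i},Q_{n_i},D_{n_i},S_{n_i}\},\quad i=1,\dots,k,$$ together with the diagonal matrices $R_{ij}$ for $1\le i<j\le k$. -/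

import Mathlib

noncomputable section

namespace FiniteHeisenberg

open Matrix

/-- `ω_n = exp (2πi / n)`. -/
def omega (n : ℕ) : ℂ := Complex.exp (2 * Real.pi * Complex.I / n)

/-- The matrix `P_n`, with entries `δ_{i, j-1}` for `i, j ∈ ℤ/n`. -/
def matP (n : ℕ) : Matrix (ZMod n) (ZMod n) ℂ :=
  Matrix.of fun i j => if i = j - 1 then 1 else 0

/-- The matrix `Q_n = diag (1, ω_n, …, ω_n ^ (n-1))`. -/
def matQ (n : ℕ) : Matrix (ZMod n) (ZMod n) ℂ :=
  Matrix.diagonal fun i => omega n ^ i.val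

/-- `ε = √ω_n = exp (πi / n)` for even `n`, and `ε = 1` for odd `n`. -/
def eps (n : ℕ) : ℂ := if Even n then Complex.exp (Real.pi * Complex.I / n) else 1

/-- The diagonal matrix `D_n` with entries `ε ^ (-i) * ω_n ^ (i choose 2)`, `0 ≤ i < n`. -/
def matD (n : ℕ) : Matrix (ZMod n) (ZMod n) ℂ :=
  Matrix.diagonal fun i => (eps n)⁻¹ ^ i.val * omega n ^ (i.val.choose 2)

/-- The discrete Fourier matrix `S_n`, with entries `ω_n ^ (i j) / √n`. -/
def matS (n : ℕ) : Matrix (ZMod n) (ZMod n) ℂ :=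
  Matrix.of fun i j => omega n ^ (i.val * j.val) / (Real.sqrt n : ℂ)

/-- The finite Heisenberg group `Π_n = {ω_n ^ j Q_n ^ k P_n ^ l | 0 ≤ j, k, l < n}` inside
`GL_n(ℂ)`. -/
def heis (n : ℕ) [NeZero n] : Set (GL (ZMod n) ℂ) :=
  {M | ∃ j k l : ℕ, j < n ∧ k < n ∧ l < n ∧
    (M : Matrix (ZMod n) (ZMod n) ℂ) = omega n ^ j • (matQ n ^ k * matP n ^ l)}

variable {k : ℕ}

/-- The configuration space `ℤ/n₁ × ⋯ × ℤ/n_k`, which indexes the rows and columns of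
`N × N` matrices, `N = n₁ ⋯ n_k`. -/
abbrev Conf (n : Fin k → ℕ) : Type := (i : Fin k) → ZMod (n i)

/-- The tensor (Kronecker) product `M₁ ⊗ ⋯ ⊗ M_k`. -/
def tensor {n : Fin k → ℕ} (M : (i : Fin k) → Matrix (ZMod (n i)) (ZMod (n i)) ℂ) :
    Matrix (Conf n) (Conf n) ℂ :=
  Matrix.of fun x y => ∏ i, M i (x i) (y i)

theorem tensor_one {n : Fin k → ℕ} :
    tensor (fun i => (1 : Matrix (ZMod (n i)) (ZMod (n i)) ℂ)) = 1 := by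
  ext x y
  by_cases h : x = y
  · subst h; simp [tensor]
  · obtain ⟨i, hi⟩ := Function.ne_iff.mp h
    rw [Matrix.one_apply_ne h]
    exact Finset.prod_eq_zero (Finset.mem_univ i) (Matrix.one_apply_ne hi)

theorem tensor_mul {n : Fin k → ℕ} [∀ i, NeZero (n i)]
    (M M' : (i : Fin k) → Matrix (ZMod (n i)) (ZMod (n i)) ℂ) :
    tensor M * tensor M' = tensor (fun i => M i * M' i) := by
  ext x y
  simp only [tensor, Matrix.mul_apply, Matrix.of_apply, ← Finset.prod_mul_distrib]
  rw [Finset.prod_univ_sum, Fintype.piFinset_univ]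

/-- The tensor product of invertible matrices, as an invertible matrix. -/
def tensorGL {n : Fin k → ℕ} [∀ i, NeZero (n i)] (M : (i : Fin k) → GL (ZMod (n i)) ℂ) :
    GL (Conf n) ℂ where
  val := tensor fun i => (M i : Matrix (ZMod (n i)) (ZMod (n i)) ℂ)
  inv := tensor fun i => ((M i)⁻¹ : GL (ZMod (n i)) ℂ)
  val_inv := by simp [tensor_mul, tensor_one]
  inv_val := by simp [tensor_mul, tensor_one]

/-- `I ⊗ M ⊗ I`, with `M` at the `i`-th tensor position. -/
def site {n : Fin k → ℕ} (i : Fin k) (M : Matrix (ZMod (n i)) (ZMod (n i)) ℂ) :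
    Matrix (Conf n) (Conf n) ℂ :=
  tensor (Pi.mulSingle i M)

/-- `R_{ij}`: block diagonal with respect to the `i`-th coordinate, with blocks
`1, T, T², …, T ^ (n_i - 1)`, where `T` is `Q_{n_j} ^ (n_j / gcd (n_i, n_j))` at the `j`-th
tensor position. -/
def matR (n : Fin k → ℕ) [∀ i, NeZero (n i)] (i j : Fin k) : Matrix (Conf n) (Conf n) ℂ :=
  Matrix.of fun x y =>
    if x i = y i then
      (site j (matQ (n j) ^ (n j / Nat.gcd (n i) (n j))) ^ (x i).val : Matrix (Conf n) (Conf n) ℂ)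
        x y
    else 0

/-- The group `Inn(GL_N(ℂ))` of inner automorphisms of `GL_N(ℂ)`. -/
abbrev Inn (n : Fin k → ℕ) [∀ i, NeZero (n i)] : Subgroup (MulAut (GL (Conf n) ℂ)) :=
  (MulAut.conj : GL (Conf n) ℂ →* MulAut (GL (Conf n) ℂ)).range

/-- `Ad_M : X ↦ M X M⁻¹`. -/
def Ad (n : Fin k → ℕ) [∀ i, NeZero (n i)] : GL (Conf n) ℂ →* Inn n :=
  MulAut.conj.rangeRestrict

/-- `𝒫_(n₁,…,n_k) = {Ad_{M₁ ⊗ ⋯ ⊗ M_k} | M_i ∈ Π_{n_i}}`. -/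
def phaseGroup (n : Fin k → ℕ) [∀ i, NeZero (n i)] : Set (Inn n) :=
  {φ | ∃ M : (i : Fin k) → GL (ZMod (n i)) ℂ, (∀ i, M i ∈ heis (n i)) ∧ φ = Ad n (tensorGL M)}

/-- The normalizer of `𝒫_(n₁,…,n_k)` in `Inn(GL_N(ℂ))`. -/
def phaseNormalizer (n : Fin k → ℕ) [∀ i, NeZero (n i)] : Subgroup (Inn n) :=
  Subgroup.normalizer (phaseGroup n)

/-- The matrices `I ⊗ P_{n_i} ⊗ I`, `I ⊗ Q_{n_i} ⊗ I`, `I ⊗ D_{n_i} ⊗ I`, `I ⊗ S_{n_i} ⊗ I`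
for all `i`, and `R_{ij}` for `i < j`. -/
def generators (n : Fin k → ℕ) [∀ i, NeZero (n i)] : Set (Matrix (Conf n) (Conf n) ℂ) :=
  {X | ∃ i, X = site i (matP (n i)) ∨ X = site i (matQ (n i)) ∨
      X = site i (matD (n i)) ∨ X = site i (matS (n i))} ∪
  {X | ∃ i j, i < j ∧ X = matR n i j}

end FiniteHeisenberg

end

/-!
Conjugation by a matrix `M` for which `Ad_M` normalizes `𝒫` permutes the Weyl operators `weylOp
v`, the tensor products of matrices `Q ^ b * P ^ a`, up to scalars (`Ad_mem_phaseNormalizer_iff`).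
Here `v` runs through the phase space `∏ᵢ (ℤ/nᵢ)²`, and since the Weyl operators of `v` and `w`
commute up to the scalar `form v w`, the permutation is additive and preserves this symplectic
form. It has to be shown that these symplectic maps are products of those coming from the
generators: the quarter turns `rot` (from `S`) and the shears `shear` (from `D`) at one site, and
the shears `cross` (from `R`) coupling two sites. What remains is a matrix that commutes with the
Weyl operators of the unit vectors up to roots of unity; a Weyl operator corrects these
(`exists_weylOp_mul_eq_smul_one`), and the rest is a scalar by Schur's lemma
(`exists_eq_smul_one_of_commute`).

The sites are treated one at a time. The images `v`, `w` of the two unit vectors at site `m` are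
`n m`-torsion points with `form v w = exp (2πi / n m)`, and they are supported on the sites from
`m` on when the unit vectors of the earlier sites are already fixed. The point is to move this
pair back to the unit vectors (`exists_move_pair`). By the Euclidean algorithm the coordinates of
`v` at site `m` become `(g, 0)`. If `|g|` is minimal, then `g` divides everything that the maps
`cross` can add to site `m`, which is `kappa` of the coordinates at other sites. As `kappa` is
adjoint to the map in the opposite direction and `w` is torsion, the value of `form v w` shows
that `g` is a unit (`exists_move_fst_eq_one`). Then the coordinates of `v` at the other sites,
being `n m`-torsion, can be cleared by `cross`, and those of `w` likewise after a quarter turn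
(`exists_move_clear`).
-/

noncomputable section

namespace FiniteHeisenberg

open Matrix

/-! ### The standard character of `ℤ/n` and the pairing between two cyclic groups -/

/-- The standard character `x ↦ exp (2πi x / n)` of `ℤ/n`. -/
abbrev chi (n : ℕ) [NeZero n] : AddChar (ZMod n) ℂ := ZMod.stdAddChar

theorem omega_pow (n : ℕ) [NeZero n] (m : ℕ) : omega n ^ m = chi n m := by
  have h := ZMod.stdAddChar_coe (N := n) (m : ℤ)
  rw [Int.cast_natCast] at h
  rw [h, omega, ← Complex.exp_nat_mul]
  congr 1
  push_cast
  ring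

theorem star_chi {n : ℕ} [NeZero n] (x : ZMod n) : star (chi n x) = chi n (-x) := by
  rw [ZMod.stdAddChar_apply, ZMod.stdAddChar_apply, AddChar.map_neg_eq_inv, Circle.coe_inv_eq_conj]
  rfl

theorem chi_neg_mul_self {n : ℕ} [NeZero n] (x : ZMod n) : chi n (-x) * chi n x = 1 := by
  rw [← AddChar.map_add_eq_mul, neg_add_cancel, AddChar.map_zero_eq_one]

theorem chi_ne_zero {n : ℕ} [NeZero n] (x : ZMod n) : chi n x ≠ 0 :=
  right_ne_zero_of_mul_eq_one (chi_neg_mul_self x)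

/-- Every `n`-th root of unity is a value of the standard character. -/
theorem exists_chi_eq {n : ℕ} [NeZero n] {c : ℂ} (hc : c ^ n = 1) : ∃ t, c = chi n t := by
  have hprim : IsPrimitiveRoot (omega n) n := Complex.isPrimitiveRoot_exp n (NeZero.ne n)
  obtain ⟨i, -, hi⟩ := hprim.eq_pow_of_pow_eq_one hc
  exact ⟨i, by rw [← hi, omega_pow]⟩

theorem dvd_mul_div_gcd (n m : ℕ) : m ∣ n * (m / n.gcd m) := by
  rw [← Nat.mul_div_assoc _ (Nat.gcd_dvd_right n m), mul_comm,
    Nat.mul_div_assoc _ (Nat.gcd_dvd_left n m)]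
  exact dvd_mul_right _ _

/-- Multiplication by `m / gcd n m`, as a homomorphism `ℤ/n → ℤ/m`. Its image is the
`n`-torsion of `ℤ/m`. -/
def kappa (n m : ℕ) : ZMod n →+ ZMod m :=
  ZMod.lift n ⟨(AddMonoidHom.mulLeft ((m / n.gcd m : ℕ) : ZMod m)).comp
      (Int.castAddHom (ZMod m)), by
    simp only [AddMonoidHom.comp_apply, Int.coe_castAddHom, Int.cast_natCast,
      AddMonoidHom.coe_mulLeft]
    rw [← Nat.cast_mul, ZMod.natCast_eq_zero_iff, mul_comm]
    exact dvd_mul_div_gcd n m⟩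

theorem kappa_intCast (n m : ℕ) (z : ℤ) :
    kappa n m z = ((m / n.gcd m : ℕ) : ZMod m) * z := by
  simp [kappa]

theorem chi_kappa_intCast (n m : ℕ) [NeZero n] [NeZero m] (z w : ℤ) :
    chi m (kappa n m z * w) = Complex.exp (2 * Real.pi * Complex.I * (z * w) / n.gcd m) := by
  have h := ZMod.stdAddChar_coe (N := m) (((m / n.gcd m : ℕ) : ℤ) * z * w)
  simp only [Int.cast_mul, Int.cast_natCast] at h
  rw [kappa_intCast, h]
  congr 1
  have hg : ((n.gcd m : ℕ) : ℂ) ≠ 0 := by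
    exact_mod_cast Nat.gcd_ne_zero_right (NeZero.ne m)
  have hm : (m : ℂ) ≠ 0 := by exact_mod_cast NeZero.ne m
  rw [Nat.cast_div (Nat.gcd_dvd_right n m) hg]
  field_simp

/-- The homomorphisms `kappa n m` and `kappa m n` are adjoint for the character pairings. -/
theorem chi_kappa (n m : ℕ) [NeZero n] [NeZero m] (x : ZMod n) (y : ZMod m) :
    chi m (kappa n m x * y) = chi n (x * kappa m n y) := by
  obtain ⟨z, rfl⟩ := ZMod.intCast_surjective x
  obtain ⟨w, rfl⟩ := ZMod.intCast_surjective y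
  rw [mul_comm (z : ZMod n), chi_kappa_intCast, chi_kappa_intCast, Nat.gcd_comm, mul_comm (w : ℂ)]

theorem exists_kappa_eq {n m : ℕ} [NeZero n] [NeZero m] {x : ZMod m} (hx : n • x = 0) :
    ∃ y, kappa n m y = x := by
  rw [← ZMod.natCast_zmod_val x, nsmul_eq_mul, ← Nat.cast_mul, ZMod.natCast_eq_zero_iff] at hx
  have hg : 0 < n.gcd m := Nat.gcd_pos_of_pos_right _ (NeZero.pos m)
  have h1 : m / n.gcd m ∣ x.val := by
    refine (Nat.coprime_div_gcd_div_gcd hg).symm.dvd_of_dvd_mul_left ?_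
    refine Nat.dvd_of_mul_dvd_mul_left hg ?_
    rwa [Nat.mul_div_cancel' (Nat.gcd_dvd_right n m), ← mul_assoc,
      Nat.mul_div_cancel' (Nat.gcd_dvd_left n m)]
  obtain ⟨c, hc⟩ := h1
  refine ⟨((c : ℤ) : ZMod n), ?_⟩
  rw [kappa_intCast, Int.cast_natCast, ← Nat.cast_mul, ← hc, ZMod.natCast_zmod_val]

/-! ### Weyl operators on one site -/

section Local

variable {n : ℕ} [NeZero n]

/-- The Weyl operator `Q_n ^ b P_n ^ a` attached to the phase space point `(a, b)`: it sends a
function `f` on `ℤ/n` to `x ↦ exp (2πi b x / n) f (x + a)`. -/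
def weyl (n : ℕ) [NeZero n] (p : ZMod n × ZMod n) : Matrix (ZMod n) (ZMod n) ℂ :=
  Matrix.of fun x y => if y = x + p.1 then chi n (p.2 * x) else 0

theorem weyl_mul_apply (p : ZMod n × ZMod n) (M : Matrix (ZMod n) (ZMod n) ℂ) (x y : ZMod n) :
    (weyl n p * M) x y = chi n (p.2 * x) * M (x + p.1) y := by
  simp [weyl, Matrix.mul_apply, ite_mul]

theorem mul_weyl_apply (p : ZMod n × ZMod n) (M : Matrix (ZMod n) (ZMod n) ℂ) (x y : ZMod n) :
    (M * weyl n p) x y = M x (y - p.1) * chi n (p.2 * (y - p.1)) := by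
  have h : ∀ z, (y = z + p.1) = (z = y - p.1) := fun z =>
    propext (by rw [eq_sub_iff_add_eq, eq_comm])
  simp [weyl, Matrix.mul_apply, mul_ite, h]

theorem weyl_mul_weyl (p q : ZMod n × ZMod n) :
    weyl n p * weyl n q = chi n (q.2 * p.1) • weyl n (p + q) := by
  ext x y
  rw [weyl_mul_apply]
  simp only [weyl, Matrix.of_apply, Matrix.smul_apply, smul_eq_mul, Prod.fst_add, Prod.snd_add,
    add_assoc, mul_ite, mul_zero, ← AddChar.map_add_eq_mul]
  congr 2
  ring

theorem weyl_zero : weyl n 0 = 1 := by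
  ext x y
  simp [weyl, Matrix.one_apply, eq_comm]

theorem matP_eq_weyl : matP n = weyl n (1, 0) := by
  ext x y
  simp [matP, weyl, eq_sub_iff_add_eq, eq_comm]

theorem matQ_eq_weyl : matQ n = weyl n (0, 1) := by
  ext x y
  simp [matQ, weyl, Matrix.diagonal_apply, omega_pow, eq_comm]

theorem matP_pow (l : ℕ) : matP n ^ l = weyl n (l, 0) := by
  induction l with
  | zero => rw [pow_zero, Nat.cast_zero]; exact weyl_zero.symm
  | succ l ih => rw [pow_succ, ih, matP_eq_weyl, weyl_mul_weyl]; simp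

theorem matQ_pow (l : ℕ) : matQ n ^ l = weyl n (0, l) := by
  induction l with
  | zero => rw [pow_zero, Nat.cast_zero]; exact weyl_zero.symm
  | succ l ih => rw [pow_succ, ih, matQ_eq_weyl, weyl_mul_weyl]; simp

theorem matQ_pow_mul_matP_pow (j l : ℕ) : matQ n ^ j * matP n ^ l = weyl n (l, j) := by
  rw [matP_pow, matQ_pow, weyl_mul_weyl]; simp

theorem matQ_pow_eq_diagonal (l : ℕ) : matQ n ^ l = diagonal fun x => chi n (l * x) := by
  rw [matQ_pow]
  ext x y
  simp [weyl, Matrix.diagonal_apply, eq_comm]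

theorem matS_apply (x y : ZMod n) : matS n x y = chi n (x * y) / (Real.sqrt n : ℂ) := by
  simp [matS, omega_pow]

theorem matS_mul_weyl (p : ZMod n × ZMod n) :
    matS n * weyl n p = chi n (-(p.1 * p.2)) • (weyl n (p.2, -p.1) * matS n) := by
  ext x y
  rw [mul_weyl_apply, Matrix.smul_apply, weyl_mul_apply, matS_apply, matS_apply, smul_eq_mul,
    div_mul_eq_mul_div, mul_div_assoc', mul_div_assoc', ← AddChar.map_add_eq_mul,
    ← AddChar.map_add_eq_mul, ← AddChar.map_add_eq_mul]
  congr 2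
  ring

theorem matS_mem_unitary : matS n ∈ Matrix.unitaryGroup (ZMod n) ℂ := by
  rw [Matrix.mem_unitaryGroup_iff]
  ext x y
  have hn : (Real.sqrt n : ℂ) * Real.sqrt n = n := by
    rw [← Complex.ofReal_mul, Real.mul_self_sqrt (Nat.cast_nonneg n), Complex.ofReal_natCast]
  have hn0 : (n : ℂ) ≠ 0 := by exact_mod_cast NeZero.ne n
  have h : ∀ z, matS n x z * star (matS n) z y = chi n (z * (x - y)) / n := fun z => by
    rw [Matrix.star_apply, matS_apply, matS_apply, star_div₀, star_chi, Complex.star_def,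
      Complex.conj_ofReal, div_mul_div_comm, hn, ← AddChar.map_add_eq_mul]
    congr 2
    ring
  rw [Matrix.mul_apply, Finset.sum_congr rfl fun z _ => h z, ← Finset.sum_div,
    AddChar.sum_mulShift _ (ZMod.isPrimitive_stdAddChar n), Matrix.one_apply, ZMod.card]
  simp only [sub_eq_zero]
  split_ifs <;> simp [hn0]

/-- The diagonal entries of `D_n`, as a function on `ℕ`. -/
def quad (n m : ℕ) : ℂ := (eps n)⁻¹ ^ m * omega n ^ (m.choose 2)

theorem quad_add (m l : ℕ) : quad n (m + l) = quad n m * quad n l * chi n (m * l) := by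
  have h : (m + l).choose 2 = m.choose 2 + l.choose 2 + m * l := by
    rw [← Nat.cast_inj (R := ℚ)]
    push_cast [Nat.cast_choose_two]
    ring
  have h2 := omega_pow n (m * l)
  push_cast at h2
  rw [quad, quad, quad, h, pow_add, pow_add, pow_add, h2]
  ring

theorem quad_self : quad n n = 1 := by
  have h2 : (n.choose 2 : ℂ) = n * (n - 1) / 2 := Nat.cast_choose_two ℂ n
  have hn0 : (n : ℂ) ≠ 0 := by exact_mod_cast NeZero.ne n
  have hw : omega n ^ n.choose 2 = Complex.exp (Real.pi * Complex.I * (n - 1)) := by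
    rw [omega, ← Complex.exp_nat_mul, h2]
    congr 1
    field_simp
  unfold quad eps
  rw [hw]
  split_ifs with h
  · rw [inv_pow, ← Complex.exp_nat_mul, ← Complex.exp_neg, ← Complex.exp_add]
    obtain ⟨r, hr⟩ := h
    rw [Complex.exp_eq_one_iff]
    refine ⟨(r : ℤ) - 1, ?_⟩
    have : (n : ℂ) = r + r := by exact_mod_cast hr
    field_simp
    rw [this]
    push_cast
    ring
  · obtain ⟨r, hr⟩ := Nat.not_even_iff_odd.mp h
    rw [inv_one, one_pow, one_mul, Complex.exp_eq_one_iff]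
    refine ⟨r, ?_⟩
    rw [hr]
    push_cast
    ring

theorem quad_mod (m : ℕ) : quad n (m % n) = quad n m := by
  have h : ∀ r l, quad n (l + n * r) = quad n l := fun r => by
    induction r with
    | zero => intro l; simp
    | succ r ih => intro l; rw [mul_add, mul_one, ← add_assoc, quad_add, quad_self, ih]; simp
  conv_rhs => rw [← Nat.mod_add_div m n]
  rw [h]

/-- `D_n` is a quadratic exponential: its diagonal entry at `x + y` is the product of those at
`x` and `y`, up to the bicharacter `exp (2πi x y / n)`. -/
theorem quad_val_add (x y : ZMod n) :
    quad n (x + y).val = quad n x.val * quad n y.val * chi n (x * y) := by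
  rw [ZMod.val_add, quad_mod, quad_add, ZMod.natCast_zmod_val, ZMod.natCast_zmod_val]

omit [NeZero n] in
theorem matD_eq_diagonal : matD n = diagonal fun x => quad n x.val := rfl

theorem norm_quad (m : ℕ) : ‖quad n m‖ = 1 := by
  have h1 : ‖omega n‖ = 1 := by
    have := omega_pow n 1
    rw [pow_one] at this
    rw [this]
    exact AddChar.norm_apply _ _
  have h2 : ‖eps n‖ = 1 := by
    unfold eps
    split_ifs
    · rw [show (Real.pi * Complex.I / n : ℂ) = ((Real.pi / n : ℝ) : ℂ) * Complex.I by
        push_cast; ring]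
      exact Complex.norm_exp_ofReal_mul_I _
    · simp
  simp [quad, h1, h2]

theorem matD_mul_weyl (p : ZMod n × ZMod n) :
    ∃ c : ℂ, matD n * weyl n p = c • (weyl n (p.1, p.2 - p.1) * matD n) := by
  have h0 : quad n p.1.val ≠ 0 := norm_ne_zero_iff.mp (by rw [norm_quad]; exact one_ne_zero)
  refine ⟨(quad n p.1.val)⁻¹, ?_⟩
  ext x y
  rw [Matrix.smul_apply, matD_eq_diagonal, diagonal_mul, mul_diagonal, weyl, weyl, of_apply,
    of_apply]
  split_ifs with h
  · subst h
    rw [quad_val_add, sub_mul, AddChar.map_sub_eq_div, mul_comm x, smul_eq_mul]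
    have := chi_ne_zero (p.1 * x)
    field_simp
  · simp

end Local

theorem diagonal_mem_unitary {ι : Type*} [Fintype ι] [DecidableEq ι] {d : ι → ℂ}
    (hd : ∀ x, ‖d x‖ = 1) : diagonal d ∈ Matrix.unitaryGroup ι ℂ := by
  rw [Matrix.mem_unitaryGroup_iff, star_eq_conjTranspose, diagonal_conjTranspose,
    diagonal_mul_diagonal, ← diagonal_one]
  congr 1
  ext x
  rw [Pi.star_apply, Complex.star_def, Complex.mul_conj, Complex.normSq_eq_norm_sq, hd]
  simp

theorem matP_mem_unitary {n : ℕ} [NeZero n] : matP n ∈ Matrix.unitaryGroup (ZMod n) ℂ := by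
  rw [Matrix.mem_unitaryGroup_iff]
  ext x y
  rw [matP_eq_weyl, weyl_mul_apply, Matrix.star_apply]
  simp [weyl, Matrix.one_apply, apply_ite]

/-! ### Tensor products of matrices -/

section Tensor

variable {k : ℕ} {n : Fin k → ℕ}

theorem tensor_smul (c : Fin k → ℂ) (M : (i : Fin k) → Matrix (ZMod (n i)) (ZMod (n i)) ℂ) :
    tensor (fun i => c i • M i) = (∏ i, c i) • tensor M := by
  ext x y
  simp [tensor, Finset.prod_mul_distrib]

theorem star_tensor (M : (i : Fin k) → Matrix (ZMod (n i)) (ZMod (n i)) ℂ) :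
    star (tensor M) = tensor fun i => star (M i) := by
  ext x y
  simp [tensor, Matrix.star_apply]

theorem site_mul_tensor [∀ i, NeZero (n i)] (i : Fin k) (A : Matrix (ZMod (n i)) (ZMod (n i)) ℂ)
    (M : (i : Fin k) → Matrix (ZMod (n i)) (ZMod (n i)) ℂ) :
    site i A * tensor M = tensor (Function.update M i (A * M i)) := by
  rw [site, tensor_mul]
  congr 1
  ext1 j
  by_cases h : j = i
  · subst h; simp
  · simp [h]

theorem tensor_mul_site [∀ i, NeZero (n i)] (i : Fin k) (A : Matrix (ZMod (n i)) (ZMod (n i)) ℂ)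
    (M : (i : Fin k) → Matrix (ZMod (n i)) (ZMod (n i)) ℂ) :
    tensor M * site i A = tensor (Function.update M i (M i * A)) := by
  rw [site, tensor_mul]
  congr 1
  ext1 j
  by_cases h : j = i
  · subst h; simp
  · simp [h]

theorem tensor_update_smul (i : Fin k) (c : ℂ) (A : Matrix (ZMod (n i)) (ZMod (n i)) ℂ)
    (M : (i : Fin k) → Matrix (ZMod (n i)) (ZMod (n i)) ℂ) :
    tensor (Function.update M i (c • A)) = c • tensor (Function.update M i A) := by
  have h : Function.update M i (c • A) =
      fun j => (Pi.mulSingle i c : Fin k → ℂ) j • Function.update M i A j := by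
    ext1 j
    by_cases h : j = i
    · subst h; simp
    · simp [h]
  rw [h, tensor_smul]
  simp

theorem site_mem_unitary [∀ i, NeZero (n i)] (i : Fin k) {A : Matrix (ZMod (n i)) (ZMod (n i)) ℂ}
    (hA : A ∈ Matrix.unitaryGroup (ZMod (n i)) ℂ) :
    site i A ∈ Matrix.unitaryGroup (Conf n) ℂ := by
  rw [Matrix.mem_unitaryGroup_iff] at hA ⊢
  rw [site, star_tensor, tensor_mul, ← tensor_one]
  congr 1
  ext1 j
  by_cases h : j = i
  · subst h; simpa using hA
  · simp [h]

theorem site_diagonal [∀ i, NeZero (n i)] (i : Fin k) (d : ZMod (n i) → ℂ) :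
    site i (diagonal d) = diagonal fun x : Conf n => d (x i) := by
  ext x y
  have hoff : ∀ (l : Fin k), x l ≠ y l →
      (Pi.mulSingle i (diagonal d) : (i : Fin k) → Matrix (ZMod (n i)) (ZMod (n i)) ℂ) l
        (x l) (y l) = 0 := fun l hl => by
    by_cases h : l = i
    · subst h; simpa using Matrix.diagonal_apply_ne _ hl
    · simpa [h] using Matrix.one_apply_ne hl
  rw [site, tensor, of_apply]
  by_cases h : x = y
  · subst h
    rw [diagonal_apply_eq, Finset.prod_eq_single i _ (by simp)]
    · simp
    · intro l _ hl
      simp [hl]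
  · obtain ⟨l, hl⟩ := Function.ne_iff.mp h
    rw [diagonal_apply_ne _ h]
    exact Finset.prod_eq_zero (Finset.mem_univ l) (hoff l hl)

theorem matR_eq_diagonal [∀ i, NeZero (n i)] (i j : Fin k) :
    matR n i j = diagonal fun x => chi (n j) (kappa (n i) (n j) (x i) * x j) := by
  ext x y
  rw [matR, of_apply, matQ_pow_eq_diagonal, site_diagonal, diagonal_pow]
  by_cases h : x = y
  · subst h
    have hk := kappa_intCast (n i) (n j) ((x i).val : ℤ)
    rw [Int.cast_natCast, Int.cast_natCast, ZMod.natCast_zmod_val] at hk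
    rw [if_pos rfl, diagonal_apply_eq, diagonal_apply_eq, Pi.pow_apply,
      ← AddChar.map_nsmul_eq_pow, hk, nsmul_eq_mul]
    congr 1
    ring
  · rw [diagonal_apply_ne _ h, diagonal_apply_ne _ h, ite_self]

end Tensor

/-! ### Weyl operators on several sites -/

/-- The phase space `∏ᵢ (ℤ/nᵢ)²`, which labels the Weyl operators: the first coordinates are
positions (exponents of the `P`), the second ones momenta (exponents of the `Q`). -/
abbrev Phase {k : ℕ} (n : Fin k → ℕ) : Type := (i : Fin k) → ZMod (n i) × ZMod (n i)

section Weyl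

variable {k : ℕ} {n : Fin k → ℕ} [∀ i, NeZero (n i)]

/-- The tensor product of the one-site Weyl operators of the components of `v`. -/
def weylOp (v : Phase n) : Matrix (Conf n) (Conf n) ℂ := tensor fun i => weyl (n i) (v i)

/-- The symplectic form on phase space, written multiplicatively. -/
def form (v w : Phase n) : ℂ := ∏ i, chi (n i) ((v i).1 * (w i).2 - (v i).2 * (w i).1)

theorem weylOp_apply (v : Phase n) (x y : Conf n) :
    weylOp v x y =
      if y = x + (fun i => (v i).1) then ∏ i, chi (n i) ((v i).2 * x i) else 0 := by
  rw [weylOp, tensor, of_apply]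
  split_ifs with h
  · subst h
    simp [weyl]
  · obtain ⟨i, hi⟩ := Function.ne_iff.mp h
    exact Finset.prod_eq_zero (Finset.mem_univ i) (by simpa [weyl] using fun h => absurd h hi)

theorem weylOp_mul (v w : Phase n) :
    weylOp v * weylOp w = (∏ i, chi (n i) ((w i).2 * (v i).1)) • weylOp (v + w) := by
  simp only [weylOp, tensor_mul, weyl_mul_weyl, tensor_smul, Pi.add_apply]

theorem prod_chi_ne_zero (x : (i : Fin k) → ZMod (n i)) : ∏ i, chi (n i) (x i) ≠ 0 :=
  Finset.prod_ne_zero_iff.mpr fun _ _ => chi_ne_zero _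

theorem weylOp_mul_comm (v w : Phase n) :
    weylOp v * weylOp w = form v w • (weylOp w * weylOp v) := by
  rw [weylOp_mul, weylOp_mul, smul_smul, add_comm w v, form, ← Finset.prod_mul_distrib]
  congr 1
  refine Finset.prod_congr rfl fun i _ => ?_
  rw [← AddChar.map_add_eq_mul]
  congr 1
  ring

theorem weylOp_zero : weylOp (0 : Phase n) = 1 := by
  rw [weylOp, ← tensor_one]
  congr 1
  ext1 i
  exact weyl_zero

theorem weylOp_mul_neg (v : Phase n) :
    weylOp v * weylOp (-v) = (∏ i, chi (n i) (((-v) i).2 * (v i).1)) • 1 := by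
  rw [weylOp_mul, add_neg_cancel, weylOp_zero]

theorem weylOp_ne_zero (v : Phase n) : weylOp v ≠ 0 := by
  intro h
  have := weylOp_mul_neg v
  rw [h, zero_mul, eq_comm, smul_eq_zero] at this
  exact this.elim (prod_chi_ne_zero _) one_ne_zero

theorem isUnit_weylOp (v : Phase n) : IsUnit (weylOp v) := by
  refine IsUnit.of_mul_eq_one ((∏ i, chi (n i) (((-v) i).2 * (v i).1))⁻¹ • weylOp (-v)) ?_
  rw [mul_smul_comm, weylOp_mul_neg, smul_smul, inv_mul_cancel₀ (prod_chi_ne_zero _), one_smul]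

theorem weylOp_injective {v w : Phase n} {c : ℂ} (h : weylOp v = c • weylOp w) : v = w := by
  have hc : c ≠ 0 := by
    rintro rfl
    exact weylOp_ne_zero v (by rw [h, zero_smul])
  have he : ∀ x y, weylOp v x y = c * weylOp w x y := fun x y => by rw [h]; rfl
  simp only [weylOp_apply] at he
  have h1 : (fun i => (v i).1) = fun i => (w i).1 := by
    have := he 0 (0 + fun i => (v i).1)
    rw [if_pos rfl] at this
    by_contra hne
    rw [if_neg (fun h => hne (add_left_cancel h)), mul_zero] at this
    exact prod_chi_ne_zero _ this
  have he2 : ∀ x : Conf n, ∏ i, chi (n i) ((v i).2 * x i) = c * ∏ i, chi (n i) ((w i).2 * x i) :=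
    fun x => by simpa [h1] using he x (x + fun i => (v i).1)
  have hc1 : c = 1 := by simpa using (he2 0).symm
  have hs : ∀ (u : Phase n) (i : Fin k),
      ∏ j, chi (n j) ((u j).2 * (Pi.single i 1 : Conf n) j) = chi (n i) (u i).2 := fun u i => by
    rw [Finset.prod_eq_single i _ (by simp)]
    · simp
    · intro j _ hj
      simp [hj]
  ext i
  · exact congrFun h1 i
  · have := he2 (Pi.single i 1)
    rw [hc1, one_mul, hs, hs] at this
    exact ZMod.injective_stdAddChar this

theorem Phase.single_eq (i : Fin k) (p : ZMod (n i) × ZMod (n i)) :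
    (Pi.single i p : Phase n) =
      p.1.val • Pi.single i (1, 0) + p.2.val • Pi.single i (0, 1) := by
  rw [← Pi.single_smul, ← Pi.single_smul, ← Pi.single_add]
  congr 1
  ext <;> simp

/-- Phase space is generated, as a monoid, by the unit vectors. -/
theorem Phase.mem_of_units (H : AddSubmonoid (Phase n))
    (h1 : ∀ i, (Pi.single i (1, 0) : Phase n) ∈ H) (h2 : ∀ i, (Pi.single i (0, 1) : Phase n) ∈ H)
    (v : Phase n) : v ∈ H := by
  rw [← Finset.univ_sum_single v]
  refine H.sum_mem fun i _ => ?_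
  rw [Phase.single_eq]
  exact H.add_mem (H.nsmul_mem (h1 i) _) (H.nsmul_mem (h2 i) _)

theorem form_single_left (i : Fin k) (p : ZMod (n i) × ZMod (n i)) (w : Phase n) :
    form (Pi.single i p) w = chi (n i) (p.1 * (w i).2 - p.2 * (w i).1) := by
  rw [form, Finset.prod_eq_single i _ (by simp)]
  · simp
  · intro j _ hj
    simp [hj]

theorem form_single_right (i : Fin k) (p : ZMod (n i) × ZMod (n i)) (v : Phase n) :
    form v (Pi.single i p) = chi (n i) ((v i).1 * p.2 - (v i).2 * p.1) := by
  rw [form, Finset.prod_eq_single i _ (by simp)]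
  · simp
  · intro j _ hj
    simp [hj]

/-- The Weyl operators act irreducibly: by Schur's lemma, a matrix commuting with those of the
unit vectors is a scalar. -/
theorem exists_eq_smul_one_of_commute {M : Matrix (Conf n) (Conf n) ℂ}
    (h1 : ∀ i, M * weylOp (Pi.single i (1, 0)) = weylOp (Pi.single i (1, 0)) * M)
    (h2 : ∀ i, M * weylOp (Pi.single i (0, 1)) = weylOp (Pi.single i (0, 1)) * M) :
    ∃ c : ℂ, M = c • 1 := by
  let H : AddSubmonoid (Phase n) :=
    { carrier := {v | M * weylOp v = weylOp v * M}
      zero_mem' := by simp [weylOp_zero]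
      add_mem' := fun {v w} hv hw => by
        have hc := prod_chi_ne_zero fun i => (w i).2 * (v i).1
        have h : (∏ i, chi (n i) ((w i).2 * (v i).1)) • (M * weylOp (v + w)) =
            (∏ i, chi (n i) ((w i).2 * (v i).1)) • (weylOp (v + w) * M) := by
          rw [← mul_smul_comm, ← smul_mul_assoc, ← weylOp_mul, ← mul_assoc, hv, mul_assoc, hw,
            mul_assoc]
        exact smul_right_injective _ hc h }
  have hH : ∀ v, M * weylOp v = weylOp v * M := Phase.mem_of_units H h1 h2
  have hr : ∀ (v : Phase n) (x y : Conf n), (M * weylOp v) x y =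
      M x (y - fun i => (v i).1) * ∏ i, chi (n i) ((v i).2 * (y - fun i => (v i).1) i) :=
    fun v x y => by
      have h : ∀ z : Conf n, (y = z + fun i => (v i).1) = (z = y - fun i => (v i).1) :=
        fun z => propext (by rw [eq_sub_iff_add_eq, eq_comm])
      simp only [Matrix.mul_apply, weylOp_apply, mul_ite, h, mul_zero]
      simp
  have hl : ∀ (v : Phase n) (x y : Conf n), (weylOp v * M) x y =
      (∏ i, chi (n i) ((v i).2 * x i)) * M (x + fun i => (v i).1) y := fun v x y => by
    simp only [Matrix.mul_apply, weylOp_apply, ite_mul, zero_mul]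
    simp
  have he := fun v x y => (hr v x y).symm.trans ((congrFun (congrFun (hH v) x) y).trans (hl v x y))
  refine ⟨M 0 0, ?_⟩
  ext x y
  rw [Matrix.smul_apply]
  by_cases h : x = y
  · subst h
    have := he (fun i => (x i, 0)) 0 x
    simp only [zero_mul, AddChar.map_zero_eq_one, Finset.prod_const_one, mul_one, one_mul,
      zero_add] at this
    have hx : (fun i => x i) = x := rfl
    rw [hx, sub_self] at this
    simp [this]
  · obtain ⟨i, hi⟩ := Function.ne_iff.mp h
    have hs : ∀ z : Conf n, ∏ j, chi (n j) (((Pi.single i (0, 1) : Phase n) j).2 * z j) =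
        chi (n i) (z i) := fun z => by
      rw [Finset.prod_eq_single i _ (by simp)]
      · simp
      · intro j _ hj
        simp [hj]
    have h0 : (fun j => ((Pi.single i (0, 1) : Phase n) j).1) = 0 := by
      ext1 j
      by_cases hj : j = i
      · subst hj; simp
      · simp [hj]
    have := he (Pi.single i (0, 1)) x y
    rw [h0, sub_zero, add_zero, hs, hs, mul_comm] at this
    rw [Matrix.one_apply_ne h, smul_zero]
    by_contra hM
    exact hi (ZMod.injective_stdAddChar (mul_right_cancel₀ hM this).symm)

end Weyl

/-! ### Matrices permuting the Weyl operators up to scalars -/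

section Implements

variable {k : ℕ} {n : Fin k → ℕ} [∀ i, NeZero (n i)]

/-- Conjugation by `M` carries the Weyl operator of `v` to that of `σ v`, up to a scalar. The
relation is written without the inverse of `M`. -/
def Implements (M : Matrix (Conf n) (Conf n) ℂ) (σ : Phase n → Phase n) : Prop :=
  ∀ v, ∃ c : ℂ, M * weylOp v = c • (weylOp (σ v) * M)

theorem Implements.one : Implements (1 : Matrix (Conf n) (Conf n) ℂ) id :=
  fun v => ⟨1, by simp⟩

theorem Implements.mul {M N : Matrix (Conf n) (Conf n) ℂ} {σ τ : Phase n → Phase n}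
    (hM : Implements M σ) (hN : Implements N τ) : Implements (M * N) (σ ∘ τ) := fun v => by
  obtain ⟨c, hc⟩ := hN v
  obtain ⟨d, hd⟩ := hM (τ v)
  refine ⟨c * d, ?_⟩
  rw [mul_assoc, hc, mul_smul_comm, ← mul_assoc, hd, smul_mul_assoc, smul_smul, mul_assoc,
    Function.comp_apply]

theorem Implements.eq_of_smul {M : Matrix (Conf n) (Conf n) ℂ} (hM : IsUnit M) {v w : Phase n}
    {c d : ℂ} (hc : c ≠ 0) (h : c • (weylOp v * M) = d • (weylOp w * M)) : v = w := by
  rw [← smul_mul_assoc, ← smul_mul_assoc] at h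
  have h2 := hM.mul_left_injective h
  refine weylOp_injective (c := c⁻¹ * d) ?_
  rw [mul_smul, ← h2, smul_smul, inv_mul_cancel₀ hc, one_smul]

theorem Implements.coeff_ne_zero {M : Matrix (Conf n) (Conf n) ℂ} (hM : IsUnit M)
    {v : Phase n} {c : ℂ} {A : Matrix (Conf n) (Conf n) ℂ} (h : M * weylOp v = c • A) :
    c ≠ 0 := by
  rintro rfl
  rw [zero_smul] at h
  exact weylOp_ne_zero v (hM.mul_right_injective (h.trans (mul_zero M).symm))

theorem Implements.map_add {M : Matrix (Conf n) (Conf n) ℂ} {σ : Phase n → Phase n}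
    (h : Implements M σ) (hM : IsUnit M) (v w : Phase n) : σ (v + w) = σ v + σ w := by
  obtain ⟨a, ha⟩ := h v
  obtain ⟨b, hb⟩ := h w
  obtain ⟨c, hc⟩ := h (v + w)
  have h1 : M * (weylOp v * weylOp w) =
      (a * b * ∏ i, chi (n i) ((σ w i).2 * (σ v i).1)) • (weylOp (σ v + σ w) * M) := by
    rw [← mul_assoc, ha, smul_mul_assoc, mul_assoc, hb, mul_smul_comm, ← mul_assoc, weylOp_mul,
      smul_mul_assoc, smul_smul, smul_smul, mul_assoc]
  rw [weylOp_mul, mul_smul_comm, hc, smul_smul] at h1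
  exact Implements.eq_of_smul hM
    (mul_ne_zero (prod_chi_ne_zero _) (Implements.coeff_ne_zero hM hc)) h1

theorem Implements.form_map {M : Matrix (Conf n) (Conf n) ℂ} {σ : Phase n → Phase n}
    (h : Implements M σ) (hM : IsUnit M) (v w : Phase n) : form (σ v) (σ w) = form v w := by
  obtain ⟨a, ha⟩ := h v
  obtain ⟨b, hb⟩ := h w
  have hab : a * b ≠ 0 :=
    mul_ne_zero (Implements.coeff_ne_zero hM ha) (Implements.coeff_ne_zero hM hb)
  have h1 : M * (weylOp v * weylOp w) = (a * b) • (weylOp (σ v) * weylOp (σ w) * M) := by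
    rw [← mul_assoc, ha, smul_mul_assoc, mul_assoc, hb, mul_smul_comm, ← mul_assoc, smul_smul]
  have h2 : M * (weylOp w * weylOp v) = (a * b) • (weylOp (σ w) * weylOp (σ v) * M) := by
    rw [← mul_assoc, hb, smul_mul_assoc, mul_assoc, ha, mul_smul_comm, ← mul_assoc, smul_smul,
      mul_comm b]
  rw [weylOp_mul_comm v, mul_smul_comm, h2, weylOp_mul_comm (σ v), smul_mul_assoc,
    smul_comm] at h1
  have h3 := smul_right_injective _ hab h1
  have h4 : weylOp (σ w) * weylOp (σ v) * M ≠ 0 := fun h0 =>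
    ((isUnit_weylOp (σ w)).mul (isUnit_weylOp (σ v)) |>.mul hM).ne_zero h0
  exact (smul_left_injective ℂ h4 h3).symm

theorem Implements.site {i : Fin k} {A : Matrix (ZMod (n i)) (ZMod (n i)) ℂ}
    {τ : ZMod (n i) × ZMod (n i) → ZMod (n i) × ZMod (n i)}
    (h : ∀ p, ∃ c : ℂ, A * weyl (n i) p = c • (weyl (n i) (τ p) * A)) :
    Implements (FiniteHeisenberg.site i A) fun v => Function.update v i (τ (v i)) := fun v => by
  obtain ⟨c, hc⟩ := h (v i)
  refine ⟨c, ?_⟩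
  rw [weylOp, weylOp, site_mul_tensor, hc, tensor_mul_site, tensor_update_smul]
  congr 2
  ext1 j
  by_cases hj : j = i
  · subst hj; simp
  · simp [hj]

theorem implements_weylOp (u : Phase n) : Implements (weylOp u) id := fun v =>
  ⟨form u v, weylOp_mul_comm u v⟩

theorem site_weyl (i : Fin k) (p : ZMod (n i) × ZMod (n i)) :
    site i (weyl (n i) p) = weylOp (Pi.single i p) := by
  rw [site, weylOp]
  congr 1
  ext1 j
  by_cases hj : j = i
  · subst hj; simp
  · simp [hj, weyl_zero]

end Implements

/-! ### Elementary symplectic moves on phase space -/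

section Moves

variable {k : ℕ} {n : Fin k → ℕ}

/-- The quarter turn `(a, b) ↦ (b, -a)` at site `i`, implemented by `S`. -/
def rot (i : Fin k) : AddMonoid.End (Phase n) where
  toFun v l := if l = i then ((v l).2, -(v l).1) else v l
  map_zero' := by ext l <;> by_cases h : l = i <;> simp [h]
  map_add' v w := by ext l <;> by_cases h : l = i <;> simp [h, add_comm]

/-- The shear `(a, b) ↦ (a, b - a)` at site `i`, implemented by `D`. -/
def shear (i : Fin k) : AddMonoid.End (Phase n) where
  toFun v l := if l = i then ((v l).1, (v l).2 - (v l).1) else v l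
  map_zero' := by ext l <;> by_cases h : l = i <;> simp [h]
  map_add' v w := by ext l <;> by_cases h : l = i <;> simp [h, add_sub_add_comm]

/-- The momentum shift of `cross i j`: at site `i` it is determined by the position at site `j`,
and conversely. -/
def crossShift (i j : Fin k) (v : Phase n) (l : Fin k) : ZMod (n l) :=
  if l = i then kappa (n j) (n l) (v j).1 else if l = j then kappa (n i) (n l) (v i).1 else 0

theorem crossShift_add (i j : Fin k) (v w : Phase n) (l : Fin k) :
    crossShift i j (v + w) l = crossShift i j v l + crossShift i j w l := by
  unfold crossShift
  split_ifs <;> simp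

/-- The shear coupling the sites `i` and `j`, implemented by `R_{ij}`. -/
def cross (i j : Fin k) : AddMonoid.End (Phase n) where
  toFun v l := ((v l).1, (v l).2 - crossShift i j v l)
  map_zero' := by
    ext l
    · rfl
    · simp [crossShift]
  map_add' v w := by
    ext l
    · rfl
    · simp [crossShift_add, add_sub_add_comm]

theorem mul_move_apply (σ τ : AddMonoid.End (Phase n)) (v : Phase n) : (σ * τ) v = σ (τ v) := rfl

theorem rot_apply (i : Fin k) (v : Phase n) (l : Fin k) :
    rot i v l = if l = i then ((v l).2, -(v l).1) else v l := rfl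

theorem shear_apply (i : Fin k) (v : Phase n) (l : Fin k) :
    shear i v l = if l = i then ((v l).1, (v l).2 - (v l).1) else v l := rfl

theorem cross_apply (i j : Fin k) (v : Phase n) (l : Fin k) :
    cross i j v l = ((v l).1, (v l).2 - crossShift i j v l) := rfl

theorem shear_pow_apply (i : Fin k) (t : ℕ) (v : Phase n) (l : Fin k) :
    (shear i ^ t) v l = if l = i then ((v l).1, (v l).2 - t * (v l).1) else v l := by
  induction t with
  | zero => simp
  | succ t ih =>
    rw [pow_succ', mul_move_apply, shear_apply, ih]
    split_ifs
    · ext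
      · rfl
      · push_cast; ring
    · rfl

theorem cross_pow_apply (i j : Fin k) (t : ℕ) (v : Phase n) (l : Fin k) :
    (cross i j ^ t) v l = ((v l).1, (v l).2 - t * crossShift i j v l) := by
  induction t generalizing l with
  | zero => simp
  | succ t ih =>
    have h : crossShift i j ((cross i j ^ t) v) l = crossShift i j v l := by
      simp only [crossShift, ih]
    rw [pow_succ', mul_move_apply, cross_apply, h, ih]
    ext
    · rfl
    · push_cast; ring

/-- The monoid generated by the moves that involve only the sites from `m` on. -/
def moves (n : Fin k → ℕ) (m : Fin k) : Submonoid (AddMonoid.End (Phase n)) :=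
  Submonoid.closure
    ({τ | ∃ i, m ≤ i ∧ (τ = rot i ∨ τ = shear i)} ∪ {τ | ∃ j, m < j ∧ τ = cross m j})

theorem rot_mem_moves {m i : Fin k} (h : m ≤ i) : rot i ∈ moves n m :=
  Submonoid.subset_closure (Or.inl ⟨i, h, Or.inl rfl⟩)

theorem shear_mem_moves {m i : Fin k} (h : m ≤ i) : shear i ∈ moves n m :=
  Submonoid.subset_closure (Or.inl ⟨i, h, Or.inr rfl⟩)

theorem cross_mem_moves {m j : Fin k} (h : m < j) : cross m j ∈ moves n m :=
  Submonoid.subset_closure (Or.inr ⟨j, h, rfl⟩)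

theorem moves_apply_of_lt {m : Fin k} {τ : AddMonoid.End (Phase n)} (hτ : τ ∈ moves n m)
    (v : Phase n) {l : Fin k} (hl : l < m) : τ v l = v l := by
  induction hτ using Submonoid.closure_induction generalizing v with
  | mem τ h =>
    rcases h with ⟨i, hi, rfl | rfl⟩ | ⟨j, hj, rfl⟩
    · rw [rot_apply, if_neg (by lia)]
    · rw [shear_apply, if_neg (by lia)]
    · rw [cross_apply, crossShift, if_neg (by lia), if_neg (by lia), sub_zero]
  | one => rfl
  | mul σ τ _ _ h1 h2 => rw [mul_move_apply, h1, h2]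

theorem moves_apply_single {m : Fin k} {τ : AddMonoid.End (Phase n)} (hτ : τ ∈ moves n m)
    {i : Fin k} (hi : i < m) (p : ZMod (n i) × ZMod (n i)) :
    τ (Pi.single i p) = Pi.single i p := by
  have h0 : ∀ l, m ≤ l → (Pi.single i p : Phase n) l = 0 := fun l hl => by
    rw [Pi.single_eq_of_ne (hi.trans_le hl).ne']
  generalize (Pi.single i p : Phase n) = v at h0
  induction hτ using Submonoid.closure_induction with
  | mem τ h =>
    ext1 l
    rcases h with ⟨i, hi, rfl | rfl⟩ | ⟨j, hj, rfl⟩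
    · rw [rot_apply]
      split_ifs with h
      · subst h; simp [h0 l hi]
      · rfl
    · rw [shear_apply]
      split_ifs with h
      · subst h; simp [h0 l hi]
      · rfl
    · rw [cross_apply, crossShift, h0 j hj.le, h0 m le_rfl]
      simp
  | one => rfl
  | mul σ τ _ _ h1 h2 => rw [mul_move_apply, h2, h1]

variable [∀ i, NeZero (n i)]

/-- The Euclidean algorithm at site `m`: the shears and the quarter turn bring a point to the
form `(g, 0)`, where `g` is a common divisor of the coordinates. -/
theorem exists_move_reduce (m : Fin k) (p q : ℤ) (v : Phase n) (hv : v m = (↑p, ↑q)) :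
    ∃ τ ∈ moves n m, ∃ g : ℤ, g ∣ p ∧ g ∣ q ∧ τ v m = (↑g, 0) := by
  induction hN : p.natAbs using Nat.strong_induction_on generalizing p q v with
  | _ N ih =>
  by_cases hp : p = 0
  · subst hp
    exact ⟨rot m, rot_mem_moves le_rfl, q, dvd_zero q, dvd_rfl, by simp [rot_apply, hv]⟩
  · let t : ℕ := ((q / p : ℤ) : ZMod (n m)).val
    have ht : (t : ZMod (n m)) = ((q / p : ℤ) : ZMod (n m)) := ZMod.natCast_zmod_val _
    have hv' : (rot m * shear m ^ t : AddMonoid.End (Phase n)) v m =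
        (((q % p : ℤ) : ZMod (n m)), ((-p : ℤ) : ZMod (n m))) := by
      rw [mul_move_apply, rot_apply, if_pos rfl, shear_pow_apply, if_pos rfl, hv, ht,
        Int.emod_def]
      push_cast
      rw [mul_comm (p : ZMod (n m))]
    have hlt : (q % p).natAbs < N := by
      have h1 := Int.emod_nonneg q hp
      have h2 := Int.emod_lt_abs q hp
      rw [Int.abs_eq_natAbs] at h2
      lia
    obtain ⟨τ, hτ, g, hg1, hg2, hg⟩ := ih _ hlt (q % p) (-p) _ hv' rfl
    have hgp : g ∣ p := (dvd_neg).mp hg2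
    exact ⟨τ * (rot m * shear m ^ t), mul_mem hτ (mul_mem (rot_mem_moves le_rfl)
      (pow_mem (shear_mem_moves le_rfl) _)), g, hgp, by
        rw [← Int.emod_add_mul_ediv q p]
        exact dvd_add hg1 (hgp.mul_right _), hg⟩

theorem exists_move_clear_site {m j : Fin k} (hj : m < j) {v : Phase n} (hm : (v m).1 = 1)
    (hvj : n m • v j = 0) :
    ∃ τ ∈ moves n m, (τ v m).1 = 1 ∧ τ v j = 0 ∧ (∀ l, l ≠ m → l ≠ j → τ v l = v l) ∧
      ∀ b, τ (Pi.single m (0, b)) = Pi.single m (0, b) := by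
  have hjm : j ≠ m := hj.ne'
  obtain ⟨y, hy⟩ := exists_kappa_eq (n := n m) (m := n j) (x := (v j).1) (congrArg Prod.fst hvj)
  obtain ⟨z, hz⟩ := exists_kappa_eq (n := n m) (m := n j) (x := (v j).2) (congrArg Prod.snd hvj)
  have hk : ∀ y : ZMod (n m), (y.val : ZMod (n j)) * kappa (n m) (n j) 1 = kappa (n m) (n j) y :=
    fun y => by
      rw [← nsmul_eq_mul, ← map_nsmul, nsmul_eq_mul, ZMod.natCast_zmod_val, mul_one]
  have hfix : ∀ t b, (cross m j ^ t) (Pi.single m (0, b) : Phase n) = Pi.single m (0, b) :=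
    fun t b => by
      ext1 l
      rw [cross_pow_apply, crossShift]
      simp [hjm]
  have hrot : ∀ b, rot j (Pi.single m (0, b) : Phase n) = Pi.single m (0, b) := fun b => by
    ext1 l
    rw [rot_apply]
    split_ifs with h
    · subst h; simp [hjm]
    · rfl
  refine ⟨cross m j ^ ((-y).val) * (rot j * cross m j ^ z.val),
    mul_mem (pow_mem (cross_mem_moves hj) _) (mul_mem (rot_mem_moves hj.le)
      (pow_mem (cross_mem_moves hj) _)), ?_, ?_, ?_, ?_⟩
  · rw [mul_move_apply, mul_move_apply, cross_pow_apply, rot_apply, if_neg hjm.symm,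
      cross_pow_apply, hm]
  · have h1 : ∀ (t : ℕ) (u : Phase n), (u m).1 = 1 →
        (cross m j ^ t) u j = ((u j).1, (u j).2 - t * kappa (n m) (n j) 1) := fun t u hu => by
      rw [cross_pow_apply, crossShift, if_neg hjm, if_pos rfl, hu]
    rw [mul_move_apply, mul_move_apply, h1, hk, rot_apply, if_pos rfl, h1 _ _ hm,
      hk, hz, ← hy, map_neg]
    · simp
    · rw [rot_apply, if_neg hjm.symm, cross_pow_apply, hm]
  · intro l hlm hlj
    rw [mul_move_apply, mul_move_apply, cross_pow_apply, rot_apply, if_neg hlj, cross_pow_apply]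
    simp [crossShift, hlm, hlj]
  · intro b
    rw [mul_move_apply, mul_move_apply, hfix, hrot, hfix]

/-- A torsion point whose position at site `m` is `1` can be moved to the unit vector, by moves
that fix the momenta at site `m`. -/
theorem exists_move_clear {m : Fin k} {v : Phase n} (hm : (v m).1 = 1)
    (hlt : ∀ i < m, v i = 0) (htor : n m • v = 0) :
    ∃ τ ∈ moves n m, τ v = Pi.single m (1, 0) ∧
      ∀ b, τ (Pi.single m (0, b)) = Pi.single m (0, b) := by
  have key : ∀ s : Finset (Fin k), ∃ τ ∈ moves n m, (τ v m).1 = 1 ∧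
      (∀ i ∈ s, i ≠ m → τ v i = 0) ∧ ∀ b, τ (Pi.single m (0, b)) = Pi.single m (0, b) := by
    intro s
    induction s using Finset.induction_on with
    | empty => exact ⟨1, one_mem _, hm, by simp, fun _ => rfl⟩
    | insert j s _ ih =>
      obtain ⟨τ, hτ, h1, h2, h3⟩ := ih
      rcases lt_trichotomy j m with hj | rfl | hj
      · refine ⟨τ, hτ, h1, fun i hi him => ?_, h3⟩
        rcases Finset.mem_insert.mp hi with rfl | hi
        · rw [moves_apply_of_lt hτ v hj, hlt i hj]
        · exact h2 i hi him
      · refine ⟨τ, hτ, h1, fun i hi him => ?_, h3⟩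
        exact h2 i (Finset.mem_of_mem_insert_of_ne hi him) him
      · have ht : n m • τ v j = 0 := by
          rw [← Pi.smul_apply, ← map_nsmul, htor, map_zero, Pi.zero_apply]
        obtain ⟨σ, hσ, g1, g2, g3, g4⟩ := exists_move_clear_site hj h1 ht
        refine ⟨σ * τ, mul_mem hσ hτ, g1, fun i hi him => ?_, fun b => ?_⟩
        · by_cases hij : i = j
          · subst hij; exact g2
          · exact (g3 i him hij).trans (h2 i (Finset.mem_of_mem_insert_of_ne hi hij) him)
        · rw [mul_move_apply, h3, g4]
  obtain ⟨τ, hτ, h1, h2, h3⟩ := key Finset.univ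
  refine ⟨shear m ^ (τ v m).2.val * τ, mul_mem (pow_mem (shear_mem_moves le_rfl) _) hτ, ?_,
    fun b => ?_⟩
  · ext1 l
    rw [mul_move_apply, shear_pow_apply]
    split_ifs with h
    · subst h
      rw [h1, ZMod.natCast_zmod_val]
      simp
    · rw [h2 l (Finset.mem_univ l) h, Pi.single_eq_of_ne h]
  · ext1 l
    rw [mul_move_apply, h3, shear_pow_apply]
    split_ifs with h
    · subst h; simp
    · rfl

/-- A torsion point with a partner of the same torsion is unimodular up to moves: its coordinates
at site `m` can be moved to `(1, *)`. Among the shapes `(g, 0)` that are reachable at site `m`, one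
with the least `|g| ≠ 0` has `g` dividing everything that the other sites can contribute, and the
symplectic form with the partner shows that `g` is a unit. -/
theorem exists_move_fst_eq_one {m : Fin k} {v w : Phase n}
    (hform : ∀ τ ∈ moves n m, form (τ v) (τ w) = chi (n m) 1)
    (hlt : ∀ i < m, v i = 0) (hw : n m • w = 0) :
    ∃ τ ∈ moves n m, (τ v m).1 = 1 := by
  classical
  let S : ℕ → Prop := fun d => d ≠ 0 ∧ ∃ τ ∈ moves n m, ∃ g : ℤ, g.natAbs = d ∧ τ v m = (↑g, 0)
  have hS : ∀ (τ : AddMonoid.End (Phase n)) (_ : τ ∈ moves n m) (p q : ℤ), (p ≠ 0 ∨ q ≠ 0) →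
      τ v m = (↑p, ↑q) → ∃ d, S d ∧ (d : ℤ) ∣ p ∧ (d : ℤ) ∣ q := by
    intro τ hτ p q hpq h
    obtain ⟨σ, hσ, g, hgp, hgq, hg⟩ := exists_move_reduce m p q (τ v) h
    refine ⟨g.natAbs, ⟨?_, σ * τ, mul_mem hσ hτ, g, rfl, hg⟩, Int.natAbs_dvd.mpr hgp,
      Int.natAbs_dvd.mpr hgq⟩
    rw [Int.natAbs_ne_zero]
    rintro rfl
    rw [zero_dvd_iff] at hgp hgq
    tauto
  have hex : ∃ d, S d := by
    -- `n m` represents the coordinate `0` by a nonzero integer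
    obtain ⟨d, hd, -⟩ := hS 1 (one_mem _) (v m).1.val ((v m).2.val + n m)
      (Or.inr (by have := NeZero.pos (n m); lia)) (by ext <;> simp)
    exact ⟨d, hd⟩
  obtain ⟨hd0, τ, hτ, g, hgd, hg⟩ := Nat.find_spec hex
  have hmin : ∀ d, S d → Nat.find hex ≤ d := fun d hd => Nat.find_min' hex hd
  generalize Nat.find hex = d at hd0 hgd hmin
  -- if `(g, x)` is reachable then `g` divides `x`
  have hdvd : ∀ σ ∈ moves n m, ∀ x : ZMod (n m), σ v m = (↑g, x) → (g : ZMod (n m)) ∣ x := by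
    intro σ hσ x hx
    have hg0 : g ≠ 0 := by rintro rfl; exact hd0 hgd.symm
    obtain ⟨e, he, heg, hex⟩ := hS σ hσ g x.val (Or.inl hg0) (by rw [hx]; ext <;> simp)
    have hde := hmin e he
    have hed : e ∣ d := by rw [← hgd]; exact Int.natCast_dvd.mp heg
    have : e = d := le_antisymm (Nat.le_of_dvd (Nat.pos_of_ne_zero hd0) hed) hde
    rw [this, ← hgd, Int.natAbs_dvd] at hex
    have := map_dvd (Int.castRingHom (ZMod (n m))) hex
    simpa using this
  have hcross : ∀ j, m < j → ∀ σ ∈ moves n m, σ v m = (↑g, 0) →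
      (g : ZMod (n m)) ∣ kappa (n j) (n m) (σ v j).1 := by
    intro j hj σ hσ h
    have := hdvd (cross m j * σ) (mul_mem (cross_mem_moves hj) hσ)
      (-kappa (n j) (n m) (σ v j).1) (by
        rw [mul_move_apply, cross_apply, crossShift, if_pos rfl, h, zero_sub])
    exact (dvd_neg).mp this
  have hwt : ∀ i, n m • (τ w i) = 0 := fun i => by
    rw [← Pi.smul_apply, ← map_nsmul, hw, map_zero, Pi.zero_apply]
  have hfac : ∀ i, ∃ s : ZMod (n m),
      chi (n i) ((τ v i).1 * (τ w i).2 - (τ v i).2 * (τ w i).1) = chi (n m) (g * s) := by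
    intro i
    rcases lt_trichotomy i m with hi | rfl | hi
    · refine ⟨0, ?_⟩
      rw [moves_apply_of_lt hτ v hi, hlt i hi]
      simp
    · exact ⟨(τ w i).2, by rw [hg]; simp⟩
    · obtain ⟨c, hc⟩ := exists_kappa_eq (n := n m) (congrArg Prod.fst (hwt i))
      obtain ⟨e, he⟩ := exists_kappa_eq (n := n m) (congrArg Prod.snd (hwt i))
      obtain ⟨s, hs⟩ := hcross i hi τ hτ hg
      obtain ⟨r, hr⟩ := hcross i hi (rot i * τ) (mul_mem (rot_mem_moves hi.le) hτ) (by
        rw [mul_move_apply, rot_apply, if_neg hi.ne, hg])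
      rw [mul_move_apply, rot_apply, if_pos rfl] at hr
      refine ⟨s * e - r * c, ?_⟩
      rw [← hc, ← he, AddChar.map_sub_eq_div, ← chi_kappa, ← chi_kappa, hs, hr,
        ← AddChar.map_sub_eq_div]
      congr 1
      ring
  choose s hs using hfac
  have hsum : (g : ZMod (n m)) * ∑ i, s i = 1 := by
    refine ZMod.injective_stdAddChar ?_
    rw [← hform τ hτ, form, Finset.prod_congr rfl fun i _ => hs i, Finset.mul_sum]
    exact Finset.induction_on Finset.univ (by simp) fun i s hi ih => by
      rw [Finset.prod_insert hi, Finset.sum_insert hi, AddChar.map_add_eq_mul, ih]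
  refine ⟨rot m * shear m ^ (-∑ i, s i).val * τ, mul_mem (mul_mem (rot_mem_moves le_rfl)
    (pow_mem (shear_mem_moves le_rfl) _)) hτ, ?_⟩
  rw [mul_move_apply, mul_move_apply, rot_apply, if_pos rfl, shear_pow_apply,
    if_pos rfl, hg, ZMod.natCast_zmod_val]
  linear_combination hsum

/-- The moves act transitively on the hyperbolic pairs of order `n m` supported on the sites from
`m` on. -/
theorem exists_move_pair {m : Fin k} {v w : Phase n}
    (hform : ∀ τ ∈ moves n m, form (τ v) (τ w) = chi (n m) 1)
    (hv : ∀ i < m, v i = 0) (hw : ∀ i < m, w i = 0) (htv : n m • v = 0) (htw : n m • w = 0) :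
    ∃ τ ∈ moves n m, τ v = Pi.single m (1, 0) ∧ τ w = Pi.single m (0, 1) := by
  obtain ⟨τ₁, hτ₁, h₁⟩ := exists_move_fst_eq_one hform hv htw
  obtain ⟨τ₂, hτ₂, h₂, -⟩ := exists_move_clear h₁
    (fun i hi => by rw [moves_apply_of_lt hτ₁ v hi, hv i hi])
    (by rw [← map_nsmul, htv, map_zero])
  have hρ : rot m * (τ₂ * τ₁) ∈ moves n m := mul_mem (rot_mem_moves le_rfl) (mul_mem hτ₂ hτ₁)
  have hw2 : ((τ₂ * τ₁) w m).2 = 1 := by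
    have := hform _ (mul_mem hτ₂ hτ₁)
    rw [mul_move_apply, h₂, form_single_left] at this
    simpa using ZMod.injective_stdAddChar this
  have hrw : ((rot m * (τ₂ * τ₁) : AddMonoid.End (Phase n)) w m).1 = 1 := by
    rw [mul_move_apply, rot_apply, if_pos rfl, hw2]
  have hrot : ∀ p, rot m (Pi.single m p : Phase n) = Pi.single m (p.2, -p.1) := fun p => by
    ext1 l
    rw [rot_apply]
    split_ifs with h
    · subst h; simp
    · rw [Pi.single_eq_of_ne h, Pi.single_eq_of_ne h]
  obtain ⟨τ₃, hτ₃, h₃, h₃'⟩ := exists_move_clear hrw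
    (fun i hi => by rw [moves_apply_of_lt hρ w hi, hw i hi])
    (by rw [← map_nsmul, htw, map_zero])
  refine ⟨rot m ^ 3 * (τ₃ * (rot m * (τ₂ * τ₁))), mul_mem (pow_mem (rot_mem_moves le_rfl) _)
    (mul_mem hτ₃ hρ), ?_, ?_⟩
  · rw [mul_move_apply, mul_move_apply, mul_move_apply,
      mul_move_apply, h₂, hrot, h₃', pow_three, mul_move_apply,
      mul_move_apply, hrot, hrot, hrot]
    simp
  · rw [mul_move_apply, mul_move_apply, h₃, pow_three, mul_move_apply,
      mul_move_apply, hrot, hrot, hrot]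
    simp

end Moves

/-! ### The generators and the moves they implement -/

section Generators

variable {k : ℕ} {n : Fin k → ℕ} [∀ i, NeZero (n i)]

theorem matR_mem_unitary (i j : Fin k) : matR n i j ∈ Matrix.unitaryGroup (Conf n) ℂ := by
  rw [matR_eq_diagonal]
  exact diagonal_mem_unitary fun x => AddChar.norm_apply _ _

theorem generators_subset_unitaryGroup :
    generators n ⊆ (Matrix.unitaryGroup (Conf n) ℂ : Set (Matrix (Conf n) (Conf n) ℂ)) := by
  rintro X (⟨i, rfl | rfl | rfl | rfl⟩ | ⟨i, j, -, rfl⟩)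
  · exact site_mem_unitary i matP_mem_unitary
  · refine site_mem_unitary i ?_
    rw [← pow_one (matQ (n i)), matQ_pow_eq_diagonal]
    exact diagonal_mem_unitary fun x => AddChar.norm_apply _ _
  · exact site_mem_unitary i (diagonal_mem_unitary fun x => norm_quad (n := n i) x.val)
  · exact site_mem_unitary i matS_mem_unitary
  · exact matR_mem_unitary i j

theorem implements_matS (i : Fin k) : Implements (site i (matS (n i))) (rot i : Phase n → _) := by
  convert Implements.site fun p => ⟨_, matS_mul_weyl (n := n i) p⟩ using 1
  ext1 v
  ext1 l
  rw [rot_apply]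
  split_ifs with h
  · subst h; simp
  · simp [h]

theorem implements_matD (i : Fin k) : Implements (site i (matD (n i))) (shear i : Phase n → _) := by
  convert Implements.site (matD_mul_weyl (n := n i)) using 1
  ext1 v
  ext1 l
  rw [shear_apply]
  split_ifs with h
  · subst h; simp
  · simp [h]

/-- The diagonal entries of `R_{ij}` are quadratic exponentials; at `x + a` they differ from the
product of those at `x` and `a` by the phases of `crossShift i j`. -/
theorem implements_matR {i j : Fin k} (hij : i ≠ j) :
    Implements (matR n i j) (cross i j : Phase n → _) := fun v => by
  have ha := chi_ne_zero (kappa (n i) (n j) (v i).1 * (v j).1)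
  refine ⟨(chi (n j) (kappa (n i) (n j) (v i).1 * (v j).1))⁻¹, ?_⟩
  have hshift : ∀ x : Conf n, ∏ l, chi (n l) (crossShift i j v l * x l) =
      chi (n j) (kappa (n i) (n j) (x i) * (v j).1) *
        chi (n j) (kappa (n i) (n j) (v i).1 * x j) := fun x => by
    rw [Finset.prod_eq_mul i j hij]
    · rw [crossShift, if_pos rfl, crossShift, if_neg hij.symm, if_pos rfl, mul_comm,
        mul_comm (kappa (n j) (n i) (v j).1), ← chi_kappa (n i), mul_comm]
    · rintro l - ⟨h1, h2⟩
      simp [crossShift, h1, h2]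
    · simp
    · simp
  ext x y
  rw [matR_eq_diagonal, diagonal_mul, Matrix.smul_apply, mul_diagonal, weylOp_apply, weylOp_apply]
  by_cases h : y = x + fun l => (v l).1
  · rw [if_pos h, if_pos (show y = x + fun l => (cross i j v l).1 from h)]
    simp only [cross_apply]
    subst h
    have h1 : ∏ l, chi (n l) (((v l).2 - crossShift i j v l) * x l) =
        (∏ l, chi (n l) ((v l).2 * x l)) / ∏ l, chi (n l) (crossShift i j v l * x l) := by
      rw [← Finset.prod_div_distrib]
      exact Finset.prod_congr rfl fun l _ => by rw [sub_mul, AddChar.map_sub_eq_div]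
    have hb := chi_ne_zero (kappa (n i) (n j) (x i) * (v j).1)
    have hc := chi_ne_zero (kappa (n i) (n j) (v i).1 * x j)
    rw [h1, hshift, Pi.add_apply, Pi.add_apply, map_add, add_mul, mul_add, mul_add,
      AddChar.map_add_eq_mul, AddChar.map_add_eq_mul, AddChar.map_add_eq_mul, smul_eq_mul]
    field_simp
  · rw [if_neg h, if_neg (show ¬ y = x + fun l => (cross i j v l).1 from h), mul_zero, zero_mul,
      smul_zero]

theorem exists_implements_of_mem_generators {X : Matrix (Conf n) (Conf n) ℂ}
    (hX : X ∈ generators n) : ∃ σ, Implements X σ := by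
  rcases hX with ⟨i, rfl | rfl | rfl | rfl⟩ | ⟨i, j, hij, rfl⟩
  · exact ⟨_, by rw [matP_eq_weyl, site_weyl]; exact implements_weylOp _⟩
  · exact ⟨_, by rw [matQ_eq_weyl, site_weyl]; exact implements_weylOp _⟩
  · exact ⟨_, implements_matD i⟩
  · exact ⟨_, implements_matS i⟩
  · exact ⟨_, implements_matR hij.ne⟩

/-- The group of unitary matrices generated by the `P`, `Q`, `D`, `S` at all sites and the
`R_{ij}`. -/
def cliffordGroup (n : Fin k → ℕ) [∀ i, NeZero (n i)] :
    Subgroup (Matrix.unitaryGroup (Conf n) ℂ) :=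
  Subgroup.closure {U : Matrix.unitaryGroup (Conf n) ℂ | U.1 ∈ generators n}

theorem exists_mem_cliffordGroup {X : Matrix (Conf n) (Conf n) ℂ} (hX : X ∈ generators n) :
    ∃ U ∈ cliffordGroup n, U.1 = X :=
  ⟨⟨X, generators_subset_unitaryGroup hX⟩, Subgroup.subset_closure hX, rfl⟩

theorem exists_implements_of_mem_moves {m : Fin k} {τ : AddMonoid.End (Phase n)}
    (hτ : τ ∈ moves n m) : ∃ U ∈ cliffordGroup n, Implements U.1 τ := by
  induction hτ using Submonoid.closure_induction with
  | mem τ h =>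
    rcases h with ⟨i, -, rfl | rfl⟩ | ⟨j, hj, rfl⟩
    · obtain ⟨U, hU, h⟩ := exists_mem_cliffordGroup (n := n)
        (Or.inl ⟨i, Or.inr (Or.inr (Or.inr rfl))⟩)
      exact ⟨U, hU, h ▸ implements_matS i⟩
    · obtain ⟨U, hU, h⟩ := exists_mem_cliffordGroup (n := n)
        (Or.inl ⟨i, Or.inr (Or.inr (Or.inl rfl))⟩)
      exact ⟨U, hU, h ▸ implements_matD i⟩
    · obtain ⟨U, hU, h⟩ := exists_mem_cliffordGroup (n := n) (Or.inr ⟨m, j, hj, rfl⟩)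
      exact ⟨U, hU, h ▸ implements_matR hj.ne⟩
  | one => exact ⟨1, one_mem _, Implements.one⟩
  | mul σ τ _ _ h1 h2 =>
    obtain ⟨U, hU, h1⟩ := h1
    obtain ⟨V, hV, h2⟩ := h2
    exact ⟨U * V, mul_mem hU hV, h1.mul h2⟩

theorem exists_mem_cliffordGroup_eq_smul_weylOp (u : Phase n) :
    ∃ U ∈ cliffordGroup n, ∃ c : ℂ, U.1 = c • weylOp u := by
  let H : AddSubmonoid (Phase n) :=
    { carrier := {u | ∃ U ∈ cliffordGroup n, ∃ c : ℂ, U.1 = c • weylOp u}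
      zero_mem' := ⟨1, one_mem _, 1, by rw [weylOp_zero, one_smul]; rfl⟩
      add_mem' := by
        rintro u v ⟨U, hU, c, hc⟩ ⟨V, hV, d, hd⟩
        refine ⟨U * V, mul_mem hU hV, c * d * ∏ i, chi (n i) ((v i).2 * (u i).1), ?_⟩
        change U.1 * V.1 = _
        rw [hc, hd, smul_mul_smul_comm, weylOp_mul, smul_smul] }
  refine Phase.mem_of_units H (fun i => ?_) (fun i => ?_) u
  · obtain ⟨U, hU, h⟩ := exists_mem_cliffordGroup (n := n) (Or.inl ⟨i, Or.inl rfl⟩)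
    exact ⟨U, hU, 1, by rw [h, matP_eq_weyl, site_weyl, one_smul]⟩
  · obtain ⟨U, hU, h⟩ := exists_mem_cliffordGroup (n := n) (Or.inl ⟨i, Or.inr (Or.inl rfl)⟩)
    exact ⟨U, hU, 1, by rw [h, matQ_eq_weyl, site_weyl, one_smul]⟩

end Generators

/-! ### Reduction of a matrix permuting the Weyl operators to a scalar -/

section Reduction

variable {k : ℕ} {n : Fin k → ℕ} [∀ i, NeZero (n i)]

theorem isUnit_unitary (U : Matrix.unitaryGroup (Conf n) ℂ) : IsUnit U.1 :=
  (Unitary.toUnits U).isUnit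

omit [∀ i, NeZero (n i)] in
theorem smul_single_eq_zero (i : Fin k) (p : ZMod (n i) × ZMod (n i)) :
    n i • (Pi.single i p : Phase n) = 0 := by
  rw [← Pi.single_smul, show n i • p = 0 by ext <;> simp, Pi.single_zero]

theorem form_single_single_of_ne {i m : Fin k} (h : i ≠ m) (p : ZMod (n i) × ZMod (n i))
    (q : ZMod (n m) × ZMod (n m)) :
    form (Pi.single i p : Phase n) (Pi.single m q) = 1 := by
  rw [form_single_left, Pi.single_eq_of_ne h]
  simp

theorem eq_zero_of_form_eq_one {w : Phase n} {i : Fin k}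
    (h1 : form (Pi.single i (1, 0)) w = 1) (h2 : form (Pi.single i (0, 1)) w = 1) : w i = 0 := by
  rw [form_single_left, ← AddChar.map_zero_eq_one (chi (n i))] at h1 h2
  have h3 := ZMod.injective_stdAddChar h1
  have h4 := ZMod.injective_stdAddChar h2
  ext
  · simpa using h4
  · simpa using h3

/-- The unit vectors can be fixed site by site: once those of the sites before `m` are fixed, the
images of the unit vectors at `m` are supported on the sites from `m` on, and a move puts them
back. -/
theorem exists_mem_cliffordGroup_fixing {M : Matrix (Conf n) (Conf n) ℂ} (hM : IsUnit M)
    {σ : Phase n → Phase n} (h : Implements M σ) (r : ℕ) (hr : r ≤ k) :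
    ∃ U ∈ cliffordGroup n, ∃ σ', Implements (U.1 * M) σ' ∧ ∀ i : Fin k, i.val < r →
      σ' (Pi.single i (1, 0)) = Pi.single i (1, 0) ∧
      σ' (Pi.single i (0, 1)) = Pi.single i (0, 1) := by
  induction r with
  | zero => exact ⟨1, one_mem _, σ, by simpa using h, fun i hi => absurd hi (Nat.not_lt_zero _)⟩
  | succ r ih =>
    obtain ⟨U, hU, σ', h', hfix⟩ := ih (by lia)
    have hUM : IsUnit (U.1 * M) := (isUnit_unitary U).mul hM
    let m : Fin k := ⟨r, by lia⟩
    let φ : Phase n →+ Phase n := AddMonoidHom.mk' σ' (h'.map_add hUM)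
    have htor : ∀ p, n m • σ' (Pi.single m p) = 0 := fun p => by
      change n m • φ _ = 0
      rw [← map_nsmul, smul_single_eq_zero, map_zero]
    have hzero : ∀ p, ∀ i < m, σ' (Pi.single m p) i = 0 := fun p i hi => by
      have hf := hfix i hi
      refine eq_zero_of_form_eq_one ?_ ?_
      · nth_rewrite 1 [← hf.1]
        rw [h'.form_map hUM, form_single_single_of_ne hi.ne]
      · nth_rewrite 1 [← hf.2]
        rw [h'.form_map hUM, form_single_single_of_ne hi.ne]
    obtain ⟨τ, hτ, hτ1, hτ2⟩ := exists_move_pair (m := m) (v := σ' (Pi.single m (1, 0)))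
      (w := σ' (Pi.single m (0, 1))) (fun τ hτ => by
        obtain ⟨V, -, hV⟩ := exists_implements_of_mem_moves hτ
        rw [hV.form_map (isUnit_unitary V), h'.form_map hUM, form_single_left]
        simp) (hzero _) (hzero _) (htor _) (htor _)
    obtain ⟨V, hV, hVτ⟩ := exists_implements_of_mem_moves hτ
    refine ⟨V * U, mul_mem hV hU, τ ∘ σ', ?_, fun i hi => ?_⟩
    · change Implements (V.1 * U.1 * M) _
      rw [mul_assoc]
      exact hVτ.mul h'
    · rcases Nat.lt_succ_iff_lt_or_eq.mp hi with hlt | heq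
      · rw [Function.comp_apply, Function.comp_apply, (hfix i hlt).1, (hfix i hlt).2]
        have him : i < m := hlt
        exact ⟨moves_apply_single hτ him _, moves_apply_single hτ him _⟩
      · have him : i = m := Fin.ext heq
        subst him
        exact ⟨hτ1, hτ2⟩

theorem weylOp_pow {v : Phase n} (hv : ∀ i, (v i).2 * (v i).1 = 0) (t : ℕ) :
    weylOp v ^ t = weylOp (t • v) := by
  induction t with
  | zero => rw [pow_zero, zero_smul, weylOp_zero]
  | succ t ih =>
    have h : ∀ i, (v i).2 * ((t • v) i).1 = 0 := fun i => by
      rw [Pi.smul_apply, Prod.smul_fst, mul_smul_comm, hv, smul_zero]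
    rw [pow_succ, ih, weylOp_mul, succ_nsmul]
    simp only [h, AddChar.map_zero_eq_one, Finset.prod_const_one, one_smul]

/-- A matrix commuting up to a scalar with the Weyl operator of a unit vector of site `i` does so up
to an `n i`-th root of unity. -/
theorem exists_chi_of_fixed {M : Matrix (Conf n) (Conf n) ℂ} (hM : IsUnit M) {i : Fin k}
    {p : ZMod (n i) × ZMod (n i)} (hp : p.2 * p.1 = 0) {c : ℂ}
    (h : M * weylOp (Pi.single i p) = c • (weylOp (Pi.single i p) * M)) :
    ∃ t, c = chi (n i) t := by
  refine exists_chi_eq ?_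
  have hp' : ∀ l, ((Pi.single i p : Phase n) l).2 * ((Pi.single i p : Phase n) l).1 = 0 :=
    fun l => by
      by_cases hl : l = i
      · subst hl; simpa using hp
      · simp [hl]
  have hpow : ∀ t : ℕ, M * weylOp (Pi.single i p) ^ t = c ^ t • (weylOp (Pi.single i p) ^ t * M) :=
    fun t => by
      induction t with
      | zero => simp
      | succ t ih =>
        rw [pow_succ, ← mul_assoc, ih, smul_mul_assoc, mul_assoc, h, mul_smul_comm, smul_smul,
          pow_succ, mul_assoc]
  have h1 := hpow (n i)
  rw [weylOp_pow hp', smul_single_eq_zero, weylOp_zero, mul_one, one_mul] at h1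
  have h2 : (1 : ℂ) • M = c ^ n i • M := by rwa [one_smul]
  have hM0 : M ≠ 0 := fun h0 => by
    have h3 := hM.mul_right_injective (a₁ := weylOp 0) (a₂ := 0) (by simp [h0])
    exact weylOp_ne_zero _ h3
  exact (smul_left_injective ℂ hM0 h2).symm

theorem exists_weylOp_mul_eq_smul_one {M : Matrix (Conf n) (Conf n) ℂ} (hM : IsUnit M)
    {σ : Phase n → Phase n} (h : Implements M σ)
    (h1 : ∀ i, σ (Pi.single i (1, 0)) = Pi.single i (1, 0))
    (h2 : ∀ i, σ (Pi.single i (0, 1)) = Pi.single i (0, 1)) :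
    ∃ u : Phase n, ∃ c : ℂ, weylOp u * M = c • 1 := by
  have hs : ∀ i, ∃ s, M * weylOp (Pi.single i (1, 0)) =
      chi (n i) s • (weylOp (Pi.single i (1, 0)) * M) := fun i => by
    obtain ⟨c, hc⟩ := h (Pi.single i (1, 0))
    rw [h1] at hc
    obtain ⟨t, rfl⟩ := exists_chi_of_fixed hM (by simp) hc
    exact ⟨t, hc⟩
  have ht : ∀ i, ∃ t, M * weylOp (Pi.single i (0, 1)) =
      chi (n i) t • (weylOp (Pi.single i (0, 1)) * M) := fun i => by
    obtain ⟨c, hc⟩ := h (Pi.single i (0, 1))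
    rw [h2] at hc
    obtain ⟨t, rfl⟩ := exists_chi_of_fixed hM (by simp) hc
    exact ⟨t, hc⟩
  choose s hs using hs
  choose t ht using ht
  -- the form with `u` cancels the phases of `M` on the unit vectors
  let u : Phase n := fun i => (-t i, s i)
  obtain ⟨c, hc⟩ := exists_eq_smul_one_of_commute (M := weylOp u * M)
    (fun i => by
      rw [mul_assoc, hs, mul_smul_comm, ← mul_assoc, weylOp_mul_comm, form_single_right,
        smul_mul_assoc, smul_smul, ← AddChar.map_add_eq_mul, mul_assoc]
      simp [u])
    (fun i => by
      rw [mul_assoc, ht, mul_smul_comm, ← mul_assoc, weylOp_mul_comm, form_single_right,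
        smul_mul_assoc, smul_smul, ← AddChar.map_add_eq_mul, mul_assoc]
      simp [u])
  exact ⟨u, c, hc⟩

/-- Up to a scalar, every matrix permuting the Weyl operators is inverse to a product of the
generators. -/
theorem exists_mem_cliffordGroup_mul_eq_smul_one {M : Matrix (Conf n) (Conf n) ℂ} (hM : IsUnit M)
    {σ : Phase n → Phase n} (h : Implements M σ) :
    ∃ U ∈ cliffordGroup n, ∃ c : ℂ, U.1 * M = c • 1 := by
  obtain ⟨U, hU, σ', h', hfix⟩ := exists_mem_cliffordGroup_fixing hM h k le_rfl
  obtain ⟨u, c, hc⟩ := exists_weylOp_mul_eq_smul_one ((isUnit_unitary U).mul hM) h'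
    (fun i => (hfix i i.2).1) (fun i => (hfix i i.2).2)
  obtain ⟨V, hV, d, hd⟩ := exists_mem_cliffordGroup_eq_smul_weylOp u
  refine ⟨V * U, mul_mem hV hU, d * c, ?_⟩
  change V.1 * U.1 * M = _
  rw [hd, mul_assoc, smul_mul_assoc, hc, smul_smul]

end Reduction

/-! ### The normalizer as the image of the matrices permuting the Weyl operators -/

section Normalizer

variable {k : ℕ} {n : Fin k → ℕ} [∀ i, NeZero (n i)]

/-- The Weyl operator of `v` as an invertible matrix. -/
def weylGL (v : Phase n) : GL (Conf n) ℂ := (isUnit_weylOp v).unit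

theorem coe_weylGL (v : Phase n) : (weylGL v : Matrix (Conf n) (Conf n) ℂ) = weylOp v := rfl

theorem Ad_eq_Ad_iff (M N : GL (Conf n) ℂ) :
    Ad n M = Ad n N ↔ ∃ c : ℂ, (M : Matrix (Conf n) (Conf n) ℂ) = c • N.1 := by
  constructor
  · intro h
    have h1 : Ad n (N⁻¹ * M) = 1 := by rw [map_mul, map_inv, h, inv_mul_cancel]
    have h2 : ∀ X : GL (Conf n) ℂ, (N⁻¹ * M) * X = X * (N⁻¹ * M) := fun X => by
      have := DFunLike.congr_fun (congrArg Subtype.val h1) X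
      exact mul_inv_eq_iff_eq_mul.mp this
    obtain ⟨c, hc⟩ := exists_eq_smul_one_of_commute (M := (N⁻¹ * M : GL (Conf n) ℂ).1)
      (fun i => congrArg Units.val (h2 (weylGL _))) (fun i => congrArg Units.val (h2 (weylGL _)))
    refine ⟨c, ?_⟩
    have h3 : M = N * (N⁻¹ * M) := (mul_inv_cancel_left N M).symm
    rw [h3, Units.val_mul, hc, mul_smul_comm, mul_one]
  · rintro ⟨c, hc⟩
    refine Subtype.ext (MulEquiv.ext fun X => ?_)
    change M * X * M⁻¹ = N * X * N⁻¹
    rw [mul_inv_eq_iff_eq_mul]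
    ext1
    rw [Units.val_mul, Units.val_mul, hc, mul_smul_comm, ← Units.val_mul, inv_mul_cancel_right,
      smul_mul_assoc, Units.val_mul]

theorem Ad_mem_phaseGroup_iff (M : GL (Conf n) ℂ) :
    Ad n M ∈ phaseGroup n ↔ ∃ (v : Phase n) (c : ℂ), M.1 = c • weylOp v := by
  constructor
  · rintro ⟨M', hM', h⟩
    obtain ⟨c, hc⟩ := (Ad_eq_Ad_iff _ _).mp h
    have hloc : ∀ i, ∃ (p : ZMod (n i) × ZMod (n i)) (d : ℂ), (M' i).1 = d • weyl (n i) p := by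
      intro i
      obtain ⟨j, a, b, -, -, -, h⟩ := hM' i
      exact ⟨_, _, by rw [h, matQ_pow_mul_matP_pow]⟩
    choose v d hd using hloc
    refine ⟨v, c * ∏ i, d i, ?_⟩
    rw [hc, mul_smul, weylOp, ← tensor_smul, ← funext hd]
    rfl
  · rintro ⟨v, c, hc⟩
    have hu : ∀ i, IsUnit (weyl (n i) (v i)) := fun i => by
      refine IsUnit.of_mul_eq_one ((chi (n i) ((-v i).2 * (v i).1))⁻¹ • weyl (n i) (-v i)) ?_
      rw [mul_smul_comm, weyl_mul_weyl, add_neg_cancel, weyl_zero, smul_smul,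
        inv_mul_cancel₀ (chi_ne_zero _), one_smul]
    refine ⟨fun i => (hu i).unit, fun i => ?_, (Ad_eq_Ad_iff _ _).mpr ⟨c, hc⟩⟩
    refine ⟨0, (v i).2.val, (v i).1.val, NeZero.pos _, ZMod.val_lt _, ZMod.val_lt _, ?_⟩
    rw [matQ_pow_mul_matP_pow, pow_zero, one_smul, ZMod.natCast_zmod_val, ZMod.natCast_zmod_val]
    rfl

theorem exists_Ad_eq (φ : Inn n) : ∃ M, Ad n M = φ := MulAut.conj.rangeRestrict_surjective φ

theorem finite_phaseGroup : Finite (phaseGroup n) := by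
  refine Set.Finite.subset (Set.finite_range fun v : Phase n => Ad n (weylGL v)) fun φ hφ => ?_
  obtain ⟨M, rfl⟩ := exists_Ad_eq φ
  obtain ⟨v, c, h⟩ := (Ad_mem_phaseGroup_iff M).mp hφ
  exact ⟨v, ((Ad_eq_Ad_iff _ _).mpr ⟨c, h⟩).symm⟩

theorem Ad_mem_phaseNormalizer_iff (M : GL (Conf n) ℂ) :
    Ad n M ∈ phaseNormalizer n ↔ ∃ σ, Implements M.1 σ := by
  constructor
  · intro h
    have key : ∀ v, ∃ v', ∃ c : ℂ, M.1 * weylOp v = c • (weylOp v' * M.1) := fun v => by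
      have h1 : Ad n (weylGL v) ∈ phaseGroup n :=
        (Ad_mem_phaseGroup_iff _).mpr ⟨v, 1, by rw [one_smul, coe_weylGL]⟩
      have h2 := (h _).mp h1
      rw [← map_inv, ← map_mul, ← map_mul] at h2
      obtain ⟨v', c, hc⟩ := (Ad_mem_phaseGroup_iff _).mp h2
      refine ⟨v', c, ?_⟩
      rw [← smul_mul_assoc, ← hc, ← Units.val_mul, inv_mul_cancel_right, Units.val_mul, coe_weylGL]
    choose σ hσ using key
    exact ⟨σ, hσ⟩
  · rintro ⟨σ, hσ⟩
    have := finite_phaseGroup (n := n)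
    refine Subgroup.mem_normalizer_fintype fun φ hφ => ?_
    obtain ⟨H, rfl⟩ := exists_Ad_eq φ
    obtain ⟨v, c, h⟩ := (Ad_mem_phaseGroup_iff H).mp hφ
    obtain ⟨d, hd⟩ := hσ v
    rw [← map_inv, ← map_mul, ← map_mul, Ad_mem_phaseGroup_iff]
    refine ⟨σ v, c * d, ?_⟩
    rw [Units.val_mul, Units.val_mul, h, mul_smul_comm, hd, smul_smul, smul_mul_assoc, mul_assoc,
      ← Units.val_mul M, mul_inv_cancel, Units.val_one, mul_one]

theorem cliffordGroup_le_comap :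
    cliffordGroup n ≤ (phaseNormalizer n).comap ((Ad n).comp Unitary.toUnits) := by
  refine (Subgroup.closure_le _).mpr fun U hU => ?_
  exact (Ad_mem_phaseNormalizer_iff _).mpr (exists_implements_of_mem_generators hU)

theorem phaseNormalizer_eq :
    (phaseNormalizer n : Set (Inn n)) =
      {φ | ∃ M ∈ cliffordGroup n, φ = Ad n (Unitary.toUnits M)} := by
  ext φ
  constructor
  · intro hφ
    obtain ⟨M, rfl⟩ := exists_Ad_eq φ
    obtain ⟨σ, hσ⟩ := (Ad_mem_phaseNormalizer_iff M).mp hφ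
    obtain ⟨U, hU, c, hc⟩ := exists_mem_cliffordGroup_mul_eq_smul_one M.isUnit hσ
    refine ⟨U⁻¹, inv_mem hU, ?_⟩
    have h1 : Ad n (Unitary.toUnits U * M) = Ad n 1 := (Ad_eq_Ad_iff _ _).mpr ⟨c, hc⟩
    rw [map_mul, map_one] at h1
    rw [map_inv, map_inv]
    exact eq_inv_of_mul_eq_one_right h1
  · rintro ⟨M, hM, rfl⟩
    exact cliffordGroup_le_comap hM

end Normalizer

end FiniteHeisenberg

end

theorem theorem37p1 (k : ℕ) (n : Fin k → ℕ) [∀ i, NeZero (n i)] :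
    ∃ G : Subgroup (Matrix.unitaryGroup (FiniteHeisenberg.Conf n) ℂ),
      (FiniteHeisenberg.phaseNormalizer n : Set (FiniteHeisenberg.Inn n)) =
        {φ | ∃ M ∈ G, φ = FiniteHeisenberg.Ad n (Unitary.toUnits M)} ∧
      FiniteHeisenberg.generators n ⊆
        (Matrix.unitaryGroup (FiniteHeisenberg.Conf n) ℂ :
          Set (Matrix (FiniteHeisenberg.Conf n) (FiniteHeisenberg.Conf n) ℂ)) ∧
      G = Subgroup.closure
        {U : Matrix.unitaryGroup (FiniteHeisenberg.Conf n) ℂ |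
          U.1 ∈ FiniteHeisenberg.generators n} :=
  ⟨FiniteHeisenberg.cliffordGroup n, FiniteHeisenberg.phaseNormalizer_eq,
    FiniteHeisenberg.generators_subset_unitaryGroup, rfl⟩
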